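/- Let $\mathscr{A}$ be a set of positive integers whose lower asymptotic density $$\underline{\mathbf d}(\mathscr{A}) := \liminf_{N\to+\infty}\frac1N\,\#\{a\in\mathscr{A} : a\le N\}$$ satisfies $\underline{\mathbf d}(\mathscr{A}) > 1-\log 2$ (so that $\mathscr{A}$ is infinite), and for every positive integer $n$ let $\tau_n$ denote the smallest element of $\mathscr{A}$ which does not divide $n$. Then the limit $$\lim_{N\to+\infty}\frac1N\sum_{n=1}^{N}\tau_n$$ exists, is finite, and is an irrational number. Moreover, the series $$\ell_1 := \sum_{n=0}^{\infty}\frac{1}{\mathrm{lcm}(1,2,\dots,n)}\qquad\text{and}\qquad \ell_2 := \sum_{n=0}^{\infty}\frac{1}{\prod_{p\text{ prime},\,p\le n}p}$$ (where the least common multiple and the product of an empty family are $1$) converge, and their sums $\ell_1$ and $\ell_2$ are irrational numbers. -/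

import Mathlib

open Filter Topology

noncomputable section

/-- The lower asymptotic density `liminf_{N → ∞} (1 / N) · #{a ∈ A | a ≤ N}` of a set `A` of
natural numbers (the quotients lie in a bounded interval, so that this real `liminf` is the usual
one). -/
def lowerAsymptoticDensity (A : Set ℕ) : ℝ :=
  liminf (fun N : ℕ => ({a ∈ A | a ≤ N}.ncard : ℝ) / (N : ℝ)) atTop

/-- `leastNonDivisor A n` is the smallest element of `A` which does not divide `n`; there is one
whenever `A` is infinite and `n` is positive. -/
def leastNonDivisor (A : Set ℕ) (n : ℕ) : ℕ :=
  sInf {a ∈ A | ¬ a ∣ n}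

/-- The `n`-th term `1 / lcm(1, 2, …, n)`, the empty `lcm` (for `n = 0`) being `1`. -/
def ellOneTerm (n : ℕ) : ℝ :=
  1 / (((Finset.Icc 1 n).lcm id : ℕ) : ℝ)

/-- The `n`-th term `1 / ∏_{p prime, p ≤ n} p`, the empty product being `1`. -/
def ellTwoTerm (n : ℕ) : ℝ :=
  1 / ((∏ p ∈ (Finset.Icc 1 n).filter Nat.Prime, p : ℕ) : ℝ)

/-- The constant `ℓ₁ = ∑_{n ≥ 0} 1 / lcm(1, 2, …, n)`. -/
def ellOne : ℝ :=
  ∑' n : ℕ, ellOneTerm n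

/-- The constant `ℓ₂ = ∑_{n ≥ 0} 1 / ∏_{p prime, p ≤ n} p`. -/
def ellTwo : ℝ :=
  ∑' n : ℕ, ellTwoTerm n

end

/-! Write `L m` for the lcm of the elements of `A` in `[1, m]`. Since `τ_n > m` iff `L m ∣ n`, we
have `∑_{n ≤ N} τ_n = ∑_m ⌊N / L m⌋`, and dominated convergence gives the mean value `∑ 1 / L m`.
The constants `ℓ₁`, `ℓ₂` are the same series for all positive integers and for the primes, so
everything reduces to the irrationality of `∑ 1 / L m`.

As the `L m` form a divisibility chain, it is enough that the tails `∑_{m > n} L n / L m` take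
arbitrarily small values (`irrational_of_tail_lt`). Let `F n` count the primes `p` dividing some `a
≤ n` in `A` with `a < p²`. A prime counted at `m` but not at `n` exceeds `√n` and is coprime to `L
n`, so `L m ≥ L n · √n ^ (F m - F n)`. If `F n ≥ c n^(1/2+η)`, then for `1/2 < σ < 1/2 + η` a
minimiser `n` of `F n - n^σ` satisfies `F m - F n ≥ m^σ - n^σ` for all `m > n`, and its tail is
`O(n^(1/2-σ) + n^(-1/2))`.

For the primes the bound on `F` is Chebyshev's. In general, by Mertens, the integers up to `N` with
a prime factor above `√N` have proportion tending to `log 2`. Lower density above `1 - log 2` forces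
a positive proportion of them into `A`, which needs many such primes
(`exists_rpow_le_card_largePrimeDivisors`). -/

/-! ### Estimates for sums of `exp (-n^σ)` -/

theorem summable_exp_neg_mul_rpow {c σ : ℝ} (hc : 0 < c) (hσ : 0 < σ) :
    Summable fun n : ℕ => Real.exp (-(c * (n : ℝ) ^ σ)) := by
  have h1 : Tendsto (fun n : ℕ => (n : ℝ) ^ σ) atTop atTop :=
    (tendsto_rpow_atTop hσ).comp tendsto_natCast_atTop_atTop
  have h2 := (isLittleO_exp_neg_mul_rpow_atTop hc (-(2 / σ))).comp_tendsto h1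
  refine summable_of_isBigO_nat (g := fun n : ℕ => 1 / (n : ℝ) ^ 2)
    (Real.summable_one_div_nat_pow.mpr (by norm_num)) ?_
  refine (h2.isBigO.congr (fun n => by simp) (fun n => ?_))
  simp only [Function.comp]
  rw [← Real.rpow_mul (Nat.cast_nonneg n), mul_neg, mul_div_cancel₀ _ hσ.ne',
    Real.rpow_neg (Nat.cast_nonneg n)]
  norm_num

/-- Bernoulli's inequality for exponents in `[0, 1]`, applied to `n / (n + k) = 1 - k / (n + k)`. -/
theorem mul_rpow_sub_one_le_sub {σ : ℝ} (h0 : 0 ≤ σ) (h1 : σ ≤ 1) {n k : ℝ} (hn : 0 ≤ n)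
    (hk : 0 < k) : σ * k * (n + k) ^ (σ - 1) ≤ (n + k) ^ σ - n ^ σ := by
  have hs : 0 < n + k := by linarith
  have h := rpow_one_add_le_one_add_mul_self (s := -(k / (n + k)))
    (by rw [neg_le_neg_iff, div_le_one hs]; linarith) h0 h1
  have e : n = (n + k) * (1 + -(k / (n + k))) := by field_simp; ring
  have e2 : n ^ σ = (n + k) ^ σ * (1 + -(k / (n + k))) ^ σ := by
    conv_lhs => rw [e]
    rw [Real.mul_rpow hs.le]
    rw [← sub_eq_add_neg, sub_nonneg, div_le_one hs]; linarith
  have h3 := mul_le_mul_of_nonneg_left h (Real.rpow_nonneg hs.le σ)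
  rw [← e2] at h3
  rw [Real.rpow_sub_one hs.ne']
  have : (n + k) ^ σ * (1 + σ * -(k / (n + k))) = (n + k) ^ σ - σ * k * ((n + k) ^ σ / (n + k)) := by
    ring
  linarith

/-- With `x = max n k` one has `n + k ≤ 2x`, so the increment is at least `k x^(σ-1) / 4`, the two
factors `1/2` coming from `σ` and `2^(σ-1)`. The case `x = n` gives a geometric term, `x = k` one
independent of `n`. -/
theorem exp_neg_rpow_sub_le {σ : ℝ} (h0 : 1 / 2 ≤ σ) (h1 : σ ≤ 1) {n k : ℝ} (hn : 0 < n)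
    (hk : 0 ≤ k) :
    Real.exp (-((n + k) ^ σ - n ^ σ)) ≤
      Real.exp (-(n ^ (σ - 1) / 4)  * k) + Real.exp (-(1 / 4 * k ^ σ)) := by
  rcases hk.eq_or_lt with rfl | hk
  · simp; positivity
  have h := mul_rpow_sub_one_le_sub (by linarith) h1 hn.le hk
  have key : ∀ x : ℝ, 0 < x → n + k ≤ 2 * x → k * x ^ (σ - 1) / 4 ≤ (n + k) ^ σ - n ^ σ := by
    intro x hx hx2
    have a1 : (2 * x) ^ (σ - 1) ≤ (n + k) ^ (σ - 1) :=
      Real.rpow_le_rpow_of_nonpos (by linarith) hx2 (by linarith)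
    have a2 : (2 : ℝ)⁻¹ ≤ 2 ^ (σ - 1) := by
      rw [← Real.rpow_neg_one]
      exact Real.rpow_le_rpow_of_exponent_le (by norm_num) (by linarith)
    have a3 : 0 < x ^ (σ - 1) := Real.rpow_pos_of_pos hx _
    rw [Real.mul_rpow (by norm_num) hx.le] at a1
    have a4 : 2⁻¹ * x ^ (σ - 1) ≤ (n + k) ^ (σ - 1) :=
      (mul_le_mul_of_nonneg_right a2 a3.le).trans a1
    have a5 : (1 / 2) * k * (2⁻¹ * x ^ (σ - 1)) ≤ σ * k * (n + k) ^ (σ - 1) := by gcongr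
    linarith
  rcases le_total k n with hkn | hkn
  · have := key n hn (by linarith)
    refine le_add_of_le_of_nonneg (Real.exp_le_exp.mpr ?_) (Real.exp_pos _).le
    linarith
  · have := key k hk (by linarith)
    refine le_add_of_nonneg_of_le (Real.exp_pos _).le (Real.exp_le_exp.mpr ?_)
    rw [Real.rpow_sub_one hk.ne', mul_div_cancel₀ _ hk.ne'] at this
    linarith

theorem tsum_exp_neg_mul_nat_le {t : ℝ} (ht : 0 < t) :
    Summable (fun k : ℕ => Real.exp (-t * k)) ∧ ∑' k : ℕ, Real.exp (-t * k) ≤ 1 + 1 / t := by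
  have e : (fun k : ℕ => Real.exp (-t * k)) = fun k : ℕ => Real.exp (-t) ^ k := by
    ext k; rw [← Real.exp_nat_mul]; ring_nf
  have h1 : Real.exp (-t) < 1 := by rw [Real.exp_lt_one_iff]; linarith
  rw [e]
  refine ⟨summable_geometric_of_lt_one (Real.exp_pos _).le h1, ?_⟩
  rw [tsum_geometric_of_lt_one (Real.exp_pos _).le h1]
  have h2 : Real.exp (-t) ≤ (1 + t)⁻¹ := by
    rw [Real.exp_neg]
    gcongr
    linarith [Real.add_one_le_exp t]
  have h3 : t / (1 + t) ≤ 1 - Real.exp (-t) := by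
    have : t / (1 + t) = 1 - (1 + t)⁻¹ := by field_simp; ring
    linarith
  calc (1 - Real.exp (-t))⁻¹ ≤ (t / (1 + t))⁻¹ := by gcongr
    _ = 1 + 1 / t := by field_simp; ring

/-! ### Irrationality from growth along a divisibility chain -/

/-- Take `n` minimising `F m - m^σ` over `m ≥ n₀`; the minimum exists because this tends to
infinity. -/
theorem exists_forall_gt_sub_le {F : ℕ → ℕ} {σ : ℝ} (hσ : 0 < σ)
    (hF : Tendsto (fun n : ℕ => (F n : ℝ) - (n : ℝ) ^ σ) atTop atTop) (n₀ : ℕ) :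
    ∃ n ≥ n₀, ∀ m > n, F n < F m ∧ (m : ℝ) ^ σ - (n : ℝ) ^ σ ≤ (F m : ℝ) - F n := by
  have hF' := (tendsto_add_atTop_iff_nat n₀).mpr hF
  rw [← Nat.cofinite_eq_atTop] at hF'
  obtain ⟨k, hk⟩ := hF'.exists_forall_le
  obtain ⟨N, hN⟩ := eventually_atTop.mp (hF.eventually_gt_atTop
    ((F (k + n₀) : ℝ) - ((k + n₀ : ℕ) : ℝ) ^ σ))
  have hle : ∀ m ≥ n₀, (F (k + n₀) : ℝ) - ((k + n₀ : ℕ) : ℝ) ^ σ ≤ (F m : ℝ) - (m : ℝ) ^ σ := by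
    intro m hm
    have := hk (m - n₀)
    rwa [Nat.sub_add_cancel hm] at this
  refine ⟨k + n₀, by omega, fun m hm => ?_⟩
  have h1 := hle m (by omega)
  refine ⟨?_, by linarith⟩
  have h2 : ((k + n₀ : ℕ) : ℝ) ^ σ < (m : ℝ) ^ σ :=
    Real.rpow_lt_rpow (by positivity) (by exact_mod_cast hm) hσ
  exact_mod_cast (by linarith : (F (k + n₀) : ℝ) < F m)

theorem irrational_of_tail_lt {L : ℕ → ℕ} (hpos : ∀ n, 0 < L n)
    (hdvd : ∀ m n, m ≤ n → L m ∣ L n) (hs : Summable fun n => 1 / (L n : ℝ))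
    (h : ∀ ε > (0 : ℝ), ∃ n, ∑' k : ℕ, (L n : ℝ) / L (k + (n + 1)) < ε) :
    Irrational (∑' n, 1 / (L n : ℝ)) := by
  rintro ⟨r, hr⟩
  obtain ⟨n, hn⟩ := h (1 / r.den) (by have := r.pos; positivity)
  have hden : (0 : ℝ) < r.den := by exact_mod_cast r.pos
  have hsplit := hs.sum_add_tsum_nat_add (n + 1)
  have hLn : (0 : ℝ) < L n := by exact_mod_cast hpos n
  have htail : ∑' k : ℕ, (L n : ℝ) / L (k + (n + 1)) =
      L n * ∑' k : ℕ, 1 / (L (k + (n + 1)) : ℝ) := by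
    rw [← tsum_mul_left]; congr 1; ext k; ring
  have hspos : 0 < ∑' k : ℕ, 1 / (L (k + (n + 1)) : ℝ) := by
    refine ((summable_nat_add_iff (n + 1)).mpr hs).tsum_pos (fun k => by positivity) 0 ?_
    have : (0 : ℝ) < L (0 + (n + 1)) := by exact_mod_cast hpos _
    positivity
  -- `L n` clears the denominators of all terms up to `n`, and `r.den` that of the sum.
  have hint : ∃ z : ℤ, (r.den : ℝ) * (L n * ∑' k : ℕ, 1 / (L (k + (n + 1)) : ℝ)) = z := by
    refine ⟨r.num * L n - r.den * ∑ m ∈ Finset.range (n + 1), ((L n / L m : ℕ) : ℤ), ?_⟩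
    have e1 : ∑' k : ℕ, 1 / (L (k + (n + 1)) : ℝ) =
        r - ∑ m ∈ Finset.range (n + 1), 1 / (L m : ℝ) := by rw [hr]; linarith
    have e2 : (L n : ℝ) * ∑ m ∈ Finset.range (n + 1), 1 / (L m : ℝ) =
        ∑ m ∈ Finset.range (n + 1), ((L n / L m : ℕ) : ℝ) := by
      rw [Finset.mul_sum]
      refine Finset.sum_congr rfl fun m hm => ?_
      rw [Nat.cast_div (hdvd m n (by simpa [Nat.lt_succ_iff] using hm))
        (by exact_mod_cast (hpos m).ne')]
      ring
    have e3 : (r.den : ℝ) * r = r.num := by exact_mod_cast Rat.den_mul_eq_num r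
    simp only [Int.cast_sub, Int.cast_mul, Int.cast_sum, Int.cast_natCast]
    rw [e1, mul_sub, e2, mul_sub, ← e3]
    ring
  obtain ⟨z, hz⟩ := hint
  have hz0 : (0 : ℝ) < z := by rw [← hz]; positivity
  have hz1 : (z : ℝ) < 1 := by
    rw [← hz, ← htail]
    rwa [lt_div_iff₀' hden] at hn
  have h0 : (0 : ℤ) < z := by exact_mod_cast hz0
  have h1 : z < 1 := by exact_mod_cast hz1
  omega

theorem exp_le_sqrt_pow {n : ℕ} (hn : 9 ≤ n) (j : ℕ) : Real.exp j ≤ √(n : ℝ) ^ j := by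
  rw [← mul_one (j : ℝ), Real.exp_nat_mul]
  have : (3 : ℝ) ≤ √(n : ℝ) := Real.le_sqrt_of_sq_le (by norm_num; exact_mod_cast hn)
  have h := Real.exp_one_lt_d9
  gcongr
  linarith

theorem summable_and_irrational_of_growth {L F : ℕ → ℕ} (hpos : ∀ n, 0 < L n)
    (hdvd : ∀ m n, m ≤ n → L m ∣ L n) (hmono : Monotone F)
    (hgrow : ∀ n m, n ≤ m → (L n : ℝ) * √(n : ℝ) ^ (F m - F n) ≤ L m)
    {σ : ℝ} (h0 : 1 / 2 < σ) (h1 : σ ≤ 1)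
    (hF : Tendsto (fun n : ℕ => (F n : ℝ) - (n : ℝ) ^ σ) atTop atTop) :
    (Summable fun n => 1 / (L n : ℝ)) ∧ Irrational (∑' n, 1 / (L n : ℝ)) := by
  have hposR : ∀ n, (0 : ℝ) < L n := fun n => by exact_mod_cast hpos n
  have hs : Summable fun n => 1 / (L n : ℝ) := by
    have hS := (summable_exp_neg_mul_rpow one_pos (by linarith : 0 < σ)).mul_left (Real.exp (F 9))
    refine summable_of_isBigO_nat hS (Asymptotics.IsBigO.of_bound 1 ?_)
    filter_upwards [hF.eventually_ge_atTop 0, eventually_ge_atTop 9] with n hn hn9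
    rw [Real.norm_of_nonneg (by positivity), Real.norm_of_nonneg (by positivity), one_mul,
      ← Real.exp_add, one_div, inv_le_comm₀ (hposR n) (Real.exp_pos _), ← Real.exp_neg]
    have a1 : (1 : ℝ) ≤ L 9 := by exact_mod_cast hpos 9
    have a2 := exp_le_sqrt_pow le_rfl (F n - F 9)
    have a3 := hgrow 9 n hn9
    rw [Nat.cast_sub (hmono hn9)] at a2
    calc Real.exp (-(F 9 + -(1 * (n : ℝ) ^ σ))) ≤ Real.exp (F n - F 9) :=
          Real.exp_le_exp.mpr (by linarith)
      _ ≤ 1 * √((9 : ℕ) : ℝ) ^ (F n - F 9) := by rwa [one_mul]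
      _ ≤ L 9 * √((9 : ℕ) : ℝ) ^ (F n - F 9) := by gcongr
      _ ≤ L n := a3
  refine ⟨hs, irrational_of_tail_lt hpos hdvd hs fun ε hε => ?_⟩
  set C := ∑' k : ℕ, Real.exp (-(1 / 4 * (k : ℝ) ^ σ)) with hC
  have hCs := summable_exp_neg_mul_rpow (c := 1 / 4) (by norm_num) (by linarith : 0 < σ)
  -- This is the final bound for the tail; it tends to `0` because `σ > 1/2`.
  have hlim : Tendsto (fun n : ℕ => Real.exp 1 * ((1 + C) * (n : ℝ) ^ (-(1 / 2 : ℝ)) +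
      4 * (n : ℝ) ^ (-(σ - 1 / 2)))) atTop (𝓝 0) := by
    have t1 : Tendsto (fun n : ℕ => (n : ℝ) ^ (-(1 / 2 : ℝ))) atTop (𝓝 0) :=
      (tendsto_rpow_neg_atTop (by norm_num)).comp tendsto_natCast_atTop_atTop
    have t2 : Tendsto (fun n : ℕ => (n : ℝ) ^ (-(σ - 1 / 2))) atTop (𝓝 0) :=
      (tendsto_rpow_neg_atTop (by linarith)).comp tendsto_natCast_atTop_atTop
    simpa using ((t1.const_mul (1 + C)).add (t2.const_mul 4)).const_mul (Real.exp 1)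
  obtain ⟨N, hN⟩ := eventually_atTop.mp (hlim.eventually_lt_const hε)
  obtain ⟨n, hn, hnm⟩ := exists_forall_gt_sub_le (by linarith) hF (max N 9)
  have hn9 : 9 ≤ n := (le_max_right _ _).trans hn
  have hn0 : (0 : ℝ) < n := by exact_mod_cast (by omega : 0 < n)
  refine ⟨n, lt_of_le_of_lt ?_ (hN n ((le_max_left _ _).trans hn))⟩
  have ht : 0 < (n : ℝ) ^ (σ - 1) / 4 := by positivity
  obtain ⟨g1, g2⟩ := tsum_exp_neg_mul_nat_le ht
  have hterm : ∀ m > n, (L n : ℝ) / L m ≤ Real.exp 1 / √(n : ℝ) *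
      Real.exp (-((m : ℝ) ^ σ - (n : ℝ) ^ σ)) := by
    intro m hm
    obtain ⟨b1, b2⟩ := hnm m hm
    have b3 := hgrow n m hm.le
    -- One factor `√n` is kept, to beat the `n^(1-σ)` from the geometric sum; the others are only
    -- used as `√n ≥ 3 > e`.
    have b4 := exp_le_sqrt_pow hn9 (F m - F n - 1)
    have b5 : √(n : ℝ) ^ (F m - F n) = √(n : ℝ) ^ (F m - F n - 1) * √(n : ℝ) := by
      rw [← pow_succ]; congr 1; omega
    have b6 : ((F m - F n - 1 : ℕ) : ℝ) = F m - F n - 1 := by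
      rw [Nat.sub_sub, Nat.cast_sub (by omega)]; push_cast; ring
    have b7 : Real.exp ((m : ℝ) ^ σ - (n : ℝ) ^ σ - 1) ≤ √(n : ℝ) ^ (F m - F n - 1) :=
      (Real.exp_le_exp.mpr (by rw [b6]; linarith)).trans b4
    have b8 : 0 < √(n : ℝ) := Real.sqrt_pos.mpr hn0
    calc (L n : ℝ) / L m ≤ L n / (L n * √(n : ℝ) ^ (F m - F n)) := by
          have := hposR n
          gcongr
      _ = 1 / √(n : ℝ) ^ (F m - F n) := by
          have := (hposR n).ne'
          field_simp
      _ ≤ 1 / (Real.exp ((m : ℝ) ^ σ - (n : ℝ) ^ σ - 1) * √(n : ℝ)) := by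
          rw [b5]; gcongr
      _ = _ := by
          rw [Real.exp_sub, Real.exp_neg]
          field_simp
  have hsum2 : Summable fun k : ℕ => Real.exp 1 / √(n : ℝ) *
      (Real.exp (-((n : ℝ) ^ (σ - 1) / 4) * k) + Real.exp (-(1 / 4 * (k : ℝ) ^ σ))) :=
    (g1.add hCs).mul_left _
  have hbound : ∀ k : ℕ, (L n : ℝ) / L (k + (n + 1)) ≤ Real.exp 1 / √(n : ℝ) *
      (Real.exp (-((n : ℝ) ^ (σ - 1) / 4) * k) + Real.exp (-(1 / 4 * (k : ℝ) ^ σ))) := by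
    intro k
    refine (hterm _ (by omega)).trans ?_
    gcongr
    refine le_trans ?_ (exp_neg_rpow_sub_le h0.le h1 hn0 (Nat.cast_nonneg k))
    apply Real.exp_le_exp.mpr
    have : ((n : ℝ) + k) ^ σ ≤ ((k + (n + 1) : ℕ) : ℝ) ^ σ := by
      apply Real.rpow_le_rpow (by positivity) _ (by linarith)
      push_cast; linarith
    linarith
  have hsum1 : Summable fun k : ℕ => (L n : ℝ) / L (k + (n + 1)) :=
    Summable.of_nonneg_of_le (fun k => by positivity) hbound hsum2
  calc _ ≤ _ := hsum1.tsum_le_tsum hbound hsum2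
    _ = Real.exp 1 / √(n : ℝ) * (∑' k : ℕ, Real.exp (-((n : ℝ) ^ (σ - 1) / 4) * k) + C) := by
      rw [tsum_mul_left, g1.tsum_add hCs]
    _ ≤ Real.exp 1 / √(n : ℝ) * (1 + 1 / ((n : ℝ) ^ (σ - 1) / 4) + C) := by gcongr
    _ = _ := by
      have c1 : √(n : ℝ) = (n : ℝ) ^ (1 / 2 : ℝ) := Real.sqrt_eq_rpow _
      have c2 : (n : ℝ) ^ (-(σ - 1 / 2)) = (n : ℝ) ^ (-(1 / 2 : ℝ)) * ((n : ℝ) ^ (σ - 1))⁻¹ := by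
        rw [← Real.rpow_neg hn0.le, ← Real.rpow_add hn0]; congr 1; ring
      rw [c2, c1, Real.rpow_neg hn0.le]
      field_simp
      ring

/-! ### Mertens-type estimates for primes -/

theorem sum_factorization_factorial_mul_log (N : ℕ) :
    Real.log N.factorial = ∑ p ∈ (Finset.Ioc 0 N).filter Nat.Prime,
      (N.factorial.factorization p : ℝ) * Real.log p := by
  rw [Real.log_nat_eq_sum_factorization, Finsupp.sum]
  refine Finset.sum_subset (fun p hp => ?_) (fun p _ hp => ?_)
  · rw [Nat.support_factorization] at hp
    have hpp := Nat.prime_of_mem_primeFactors hp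
    simp only [Finset.mem_filter, Finset.mem_Ioc]
    exact ⟨⟨hpp.pos, hpp.dvd_factorial.mp (Nat.dvd_of_mem_primeFactors hp)⟩, hpp⟩
  · rw [Finsupp.notMem_support_iff.mp hp]; simp

theorem div_le_factorization_factorial {p N : ℕ} (hp : p.Prime) :
    N / p ≤ N.factorial.factorization p := by
  rw [Nat.factorization_factorial hp (b := Nat.log p N + 2) (by omega)]
  have := Finset.single_le_sum (f := fun i => N / p ^ i) (s := Finset.Ico 1 (Nat.log p N + 2))
    (fun _ _ => Nat.zero_le _) (a := 1) (by simp)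
  simpa using this

theorem factorization_factorial_le_div {p N : ℕ} (hp : p.Prime) :
    (N.factorial.factorization p : ℝ) ≤ (N : ℝ) / ((p : ℝ) - 1) := by
  have := Fact.mk hp
  have h1 : (1 : ℝ) < p := by exact_mod_cast hp.one_lt
  rw [le_div_iff₀ (by linarith), Nat.factorization_def _ hp]
  have h : (p - 1) * padicValNat p N.factorial ≤ N := by
    rw [sub_one_mul_padicValNat_factorial]; omega
  have h' : ((p - 1 : ℕ) : ℝ) * padicValNat p N.factorial ≤ N := by exact_mod_cast h
  rw [Nat.cast_sub hp.one_le, Nat.cast_one] at h'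
  linarith

/-- Compare with `log N!`: replacing `⌊N/p⌋` by `N/p` costs at most `θ(N) ≤ N log 4`. -/
theorem sum_log_div_prime_le {N : ℕ} (hN : 0 < N) :
    ∑ p ∈ (Finset.Ioc 0 N).filter Nat.Prime, Real.log p / p ≤ Real.log N + Real.log 4 := by
  have hN' : (0 : ℝ) < N := by exact_mod_cast hN
  refine le_of_mul_le_mul_left ?_ hN'
  have hfac : Real.log N.factorial ≤ N * Real.log N := by
    rw [← Real.log_pow]
    exact Real.log_le_log (by positivity) (by exact_mod_cast Nat.factorial_le_pow N)
  have htheta := Chebyshev.theta_le_log4_mul_x hN'.le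
  rw [Chebyshev.theta, Nat.floor_natCast] at htheta
  calc (N : ℝ) * ∑ p ∈ (Finset.Ioc 0 N).filter Nat.Prime, Real.log p / p
      = ∑ p ∈ (Finset.Ioc 0 N).filter Nat.Prime, (N / p : ℝ) * Real.log p := by
        rw [Finset.mul_sum]; exact Finset.sum_congr rfl fun p _ => by ring
    _ ≤ ∑ p ∈ (Finset.Ioc 0 N).filter Nat.Prime,
        ((N.factorial.factorization p : ℝ) * Real.log p + Real.log p) := by
        refine Finset.sum_le_sum fun p hp => ?_
        have hpp := (Finset.mem_filter.mp hp).2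
        have h1 : (N / p : ℝ) ≤ (N.factorial.factorization p : ℝ) + 1 := by
          have h2 : ((N / p : ℕ) : ℝ) ≤ N.factorial.factorization p := by
            exact_mod_cast div_le_factorization_factorial hpp
          have h3 := Nat.lt_floor_add_one ((N : ℝ) / p)
          rw [Nat.floor_div_eq_div] at h3
          linarith
        have h4 : 0 ≤ Real.log p := Real.log_natCast_nonneg p
        nlinarith
    _ = Real.log N.factorial + ∑ p ∈ (Finset.Ioc 0 N).filter Nat.Prime, Real.log p := by
        rw [Finset.sum_add_distrib, sum_factorization_factorial_mul_log]
    _ ≤ N * (Real.log N + Real.log 4) := by linarith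

theorem log_div_sub_one_le {p : ℕ} (hp : 2 ≤ p) :
    Real.log p / (p - 1 : ℝ) ≤ Real.log p / p + 4 * (p : ℝ) ^ (-(3 / 2) : ℝ) := by
  have h2 : (2 : ℝ) ≤ p := by exact_mod_cast hp
  have h0 : (0 : ℝ) < p := by linarith
  have h1 : (0 : ℝ) < p - 1 := by linarith
  have hl := Real.log_le_rpow_div h0.le (ε := 1 / 2) (by norm_num)
  have e : (p : ℝ) ^ (-(3 / 2) : ℝ) = (p : ℝ) ^ (1 / 2 : ℝ) / (p : ℝ) ^ 2 := by
    rw [← Real.rpow_natCast (p : ℝ) 2, ← Real.rpow_sub h0]; norm_num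
  have hs : Real.log p / (p - 1 : ℝ) - Real.log p / p = Real.log p / (p * (p - 1)) := by
    field_simp; ring
  have : Real.log p / (p * (p - 1)) ≤ 4 * ((p : ℝ) ^ (1 / 2 : ℝ) / (p : ℝ) ^ 2) := by
    calc Real.log p / (p * (p - 1)) ≤ ((p : ℝ) ^ (1 / 2 : ℝ) / (1 / 2)) / (p * (p / 2)) := by
          gcongr
          linarith
      _ = _ := by field_simp; norm_num
  rw [e]
  linarith

/-- Stirling bounds `log N!` below, and Legendre's formula bounds the exponent of `p` by `N / (p -
1)`; the excess over `N / p` sums to `O(N)`. -/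
theorem exists_le_sum_log_div_prime :
    ∃ C : ℝ, ∀ N : ℕ, 0 < N →
      Real.log N - C ≤ ∑ p ∈ (Finset.Ioc 0 N).filter Nat.Prime, Real.log p / p := by
  have hs : Summable fun n : ℕ => 4 * (n : ℝ) ^ (-(3 / 2) : ℝ) :=
    (Real.summable_nat_rpow.mpr (by norm_num)).mul_left 4
  refine ⟨1 + ∑' n : ℕ, 4 * (n : ℝ) ^ (-(3 / 2) : ℝ), fun N hN => ?_⟩
  have hN' : (0 : ℝ) < N := by exact_mod_cast hN
  have hst := Stirling.le_log_factorial_stirling hN.ne'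
  have hl1 : 0 ≤ Real.log N := Real.log_natCast_nonneg N
  have hl2 : 0 ≤ Real.log (2 * Real.pi) := Real.log_nonneg (by linarith [Real.pi_gt_three])
  have hup : Real.log N.factorial ≤ N * (∑ p ∈ (Finset.Ioc 0 N).filter Nat.Prime, Real.log p / p +
      ∑' n : ℕ, 4 * (n : ℝ) ^ (-(3 / 2) : ℝ)) := by
    calc Real.log N.factorial ≤ ∑ p ∈ (Finset.Ioc 0 N).filter Nat.Prime,
          N * (Real.log p / p + 4 * (p : ℝ) ^ (-(3 / 2) : ℝ)) := by
          rw [sum_factorization_factorial_mul_log]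
          refine Finset.sum_le_sum fun p hp => ?_
          have hpp := (Finset.mem_filter.mp hp).2
          calc (N.factorial.factorization p : ℝ) * Real.log p
              ≤ (N / (p - 1 : ℝ)) * Real.log p :=
                mul_le_mul_of_nonneg_right (factorization_factorial_le_div hpp)
                  (Real.log_natCast_nonneg p)
            _ = N * (Real.log p / (p - 1 : ℝ)) := by ring
            _ ≤ _ := mul_le_mul_of_nonneg_left (log_div_sub_one_le hpp.two_le) hN'.le
      _ ≤ _ := by
          rw [← Finset.mul_sum, Finset.sum_add_distrib]
          gcongr
          exact hs.sum_le_tsum _ fun n _ => by positivity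
  refine le_of_mul_le_mul_left ?_ hN'
  linarith

theorem exists_abs_sum_log_div_prime_sub_log_le :
    ∃ C : ℝ, 0 < C ∧ ∀ x : ℝ, 1 ≤ x →
      |∑ p ∈ (Finset.Ioc 0 ⌊x⌋₊).filter Nat.Prime, Real.log p / p - Real.log x| ≤ C := by
  obtain ⟨C, hC⟩ := exists_le_sum_log_div_prime
  refine ⟨|C| + Real.log 4, by positivity, fun x hx => ?_⟩
  have hf : 0 < ⌊x⌋₊ := Nat.floor_pos.mpr hx
  have hf' : (1 : ℝ) ≤ ⌊x⌋₊ := by exact_mod_cast hf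
  have h1 := hC _ hf
  have h2 := sum_log_div_prime_le hf
  have h3 : Real.log ⌊x⌋₊ ≤ Real.log x :=
    Real.log_le_log (by linarith) (Nat.floor_le (by linarith))
  have h4 : Real.log x ≤ Real.log ⌊x⌋₊ + Real.log 4 := by
    rw [← Real.log_mul (by linarith) (by norm_num)]
    refine Real.log_le_log (by linarith) ?_
    linarith [Nat.lt_floor_add_one x]
  rw [abs_le]
  constructor <;> linarith [le_abs_self C, neg_abs_le C, abs_nonneg C]

theorem exists_abs_sum_Ioc_log_div_prime_sub_le :
    ∃ C : ℝ, 0 < C ∧ ∀ a b : ℝ, 1 ≤ a → a ≤ b →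
      |∑ p ∈ (Finset.Ioc ⌊a⌋₊ ⌊b⌋₊).filter Nat.Prime, Real.log p / p -
        (Real.log b - Real.log a)| ≤ C := by
  obtain ⟨C, hC0, hC⟩ := exists_abs_sum_log_div_prime_sub_log_le
  refine ⟨2 * C, by linarith, fun a b ha hab => ?_⟩
  have h1 := abs_le.mp (hC a ha)
  have h2 := abs_le.mp (hC b (ha.trans hab))
  have h3 : ∑ p ∈ (Finset.Ioc 0 ⌊a⌋₊).filter Nat.Prime, Real.log p / p +
      ∑ p ∈ (Finset.Ioc ⌊a⌋₊ ⌊b⌋₊).filter Nat.Prime, Real.log p / p =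
      ∑ p ∈ (Finset.Ioc 0 ⌊b⌋₊).filter Nat.Prime, Real.log p / p := by
    simp only [Finset.sum_filter]
    exact Finset.sum_Ioc_consecutive _ (Nat.zero_le _) (Nat.floor_mono hab)
  rw [abs_le]
  constructor <;> linarith [h1.1, h1.2, h2.1, h2.2]

theorem exists_sum_inv_prime_bounds :
    ∃ C : ℝ, 0 < C ∧ ∀ a b : ℝ, 1 < a → a ≤ b →
      (Real.log b - Real.log a - C) / Real.log b ≤
        ∑ p ∈ (Finset.Ioc ⌊a⌋₊ ⌊b⌋₊).filter Nat.Prime, 1 / (p : ℝ) ∧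
      ∑ p ∈ (Finset.Ioc ⌊a⌋₊ ⌊b⌋₊).filter Nat.Prime, 1 / (p : ℝ) ≤
        (Real.log b - Real.log a + C) / Real.log a := by
  obtain ⟨C, hC0, hC⟩ := exists_abs_sum_Ioc_log_div_prime_sub_le
  refine ⟨C, hC0, fun a b ha hab => ?_⟩
  have h := abs_le.mp (hC a b ha.le hab)
  have hla : 0 < Real.log a := Real.log_pos ha
  have hlb : 0 < Real.log b := Real.log_pos (ha.trans_le hab)
  rw [div_le_iff₀ hlb, le_div_iff₀ hla, Finset.sum_mul, Finset.sum_mul]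
  have hmem : ∀ p ∈ (Finset.Ioc ⌊a⌋₊ ⌊b⌋₊).filter Nat.Prime, a ≤ p ∧ (p : ℝ) ≤ b := by
    intro p hp
    simp only [Finset.mem_filter, Finset.mem_Ioc] at hp
    exact ⟨(Nat.lt_of_floor_lt hp.1.1).le,
      (Nat.le_floor_iff (by linarith)).mp hp.1.2⟩
  have e : ∀ p : ℕ, Real.log p / p = 1 / (p : ℝ) * Real.log p := fun p => by ring
  simp only [e] at h
  constructor
  · refine le_trans (by linarith [h.1]) (Finset.sum_le_sum fun p hp => ?_)
    obtain ⟨h1, h2⟩ := hmem p hp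
    exact mul_le_mul_of_nonneg_left (Real.log_le_log (by linarith) h2) (by positivity)
  · refine (Finset.sum_le_sum fun p hp => ?_).trans (by linarith [h.2] :
      ∑ p ∈ (Finset.Ioc ⌊a⌋₊ ⌊b⌋₊).filter Nat.Prime, 1 / (p : ℝ) * Real.log p ≤ _)
    obtain ⟨h1, h2⟩ := hmem p hp
    exact mul_le_mul_of_nonneg_left (Real.log_le_log (by linarith) h1) (by positivity)

theorem eventually_sum_inv_prime_sqrt_rpow_le {δ : ℝ} (hδ : 0 < δ) :
    ∃ η : ℝ, 0 < η ∧ η ≤ 1 / 2 ∧ ∀ᶠ N : ℕ in atTop,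
      ∑ p ∈ (Finset.Ioc ⌊(N : ℝ) ^ (1 / 2 : ℝ)⌋₊ ⌊(N : ℝ) ^ (1 / 2 + η)⌋₊).filter Nat.Prime,
        1 / (p : ℝ) ≤ δ := by
  obtain ⟨C, hC0, hC⟩ := exists_sum_inv_prime_bounds
  refine ⟨min (δ / 4) (1 / 2), by positivity, min_le_right _ _, ?_⟩
  set η := min (δ / 4) (1 / 2)
  have hη0 : 0 < η := by positivity
  have hη : η ≤ δ / 4 := min_le_left _ _
  have hlog : Tendsto (fun N : ℕ => Real.log N) atTop atTop :=
    Real.tendsto_log_atTop.comp tendsto_natCast_atTop_atTop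
  filter_upwards [eventually_ge_atTop 2, hlog.eventually_ge_atTop (4 * C / δ)] with N hN2 hNl
  have h1 : (1 : ℝ) < N := by exact_mod_cast (by omega : 1 < N)
  have hl : 0 < Real.log N := Real.log_pos h1
  refine ((hC _ _ (Real.one_lt_rpow h1 (by norm_num))
    (Real.rpow_le_rpow_of_exponent_le h1.le (by linarith))).2).trans ?_
  rw [Real.log_rpow (by linarith), Real.log_rpow (by linarith), div_le_iff₀ (by linarith)]
  rw [div_le_iff₀ hδ] at hNl
  nlinarith

/-- Bounding `log p` by its value at the right end loses too much on a long interval, so `(x^K,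
x^(K+J)]` is cut at the powers of `x`; each piece contributes at least `(1 - C / log x) / (K + i +
1)`. -/
theorem sum_Ioc_pow_inv_prime_ge :
    ∃ C : ℝ, 0 < C ∧ ∀ x : ℝ, 1 < x → ∀ K J : ℕ, 0 < K →
      (1 - C / Real.log x) * ∑ i ∈ Finset.range J, 1 / ((K : ℝ) + i + 1) ≤
        ∑ p ∈ (Finset.Ioc ⌊x ^ K⌋₊ ⌊x ^ (K + J)⌋₊).filter Nat.Prime, 1 / (p : ℝ) := by
  obtain ⟨C, hC0, hC⟩ := exists_sum_inv_prime_bounds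
  refine ⟨C, hC0, fun x hx K J hK => ?_⟩
  have hl : 0 < Real.log x := Real.log_pos hx
  induction J with
  | zero => simp
  | succ J ih =>
    have h := (hC (x ^ (K + J)) (x ^ (K + (J + 1))) (one_lt_pow₀ hx (by omega))
      (pow_le_pow_right₀ hx.le (by omega))).1
    have e : ∑ p ∈ (Finset.Ioc ⌊x ^ K⌋₊ ⌊x ^ (K + J)⌋₊).filter Nat.Prime, 1 / (p : ℝ) +
        ∑ p ∈ (Finset.Ioc ⌊x ^ (K + J)⌋₊ ⌊x ^ (K + (J + 1))⌋₊).filter Nat.Prime, 1 / (p : ℝ) =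
        ∑ p ∈ (Finset.Ioc ⌊x ^ K⌋₊ ⌊x ^ (K + (J + 1))⌋₊).filter Nat.Prime, 1 / (p : ℝ) := by
      simp only [Finset.sum_filter]
      exact Finset.sum_Ioc_consecutive _
        (Nat.floor_mono (pow_le_pow_right₀ hx.le (by omega)))
        (Nat.floor_mono (pow_le_pow_right₀ hx.le (by omega)))
    rw [← e, Finset.sum_range_succ, mul_add]
    refine add_le_add ih (le_trans (le_of_eq ?_) h)
    rw [Real.log_pow, Real.log_pow]
    push_cast
    have : (K : ℝ) + J + 1 ≠ 0 := by positivity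
    have : (K : ℝ) + (J + 1) ≠ 0 := by positivity
    field_simp
    ring

theorem log_div_le_sum_inv (K J : ℕ) :
    Real.log (((K : ℝ) + J + 1) / (K + 1)) ≤ ∑ i ∈ Finset.range J, 1 / ((K : ℝ) + i + 1) := by
  induction J with
  | zero => simp [div_self (by positivity : (K : ℝ) + 1 ≠ 0)]
  | succ J ih =>
    rw [Finset.sum_range_succ]
    have e : ((K : ℝ) + (J + 1 : ℕ) + 1) / (K + 1) =
        ((K : ℝ) + J + 1) / (K + 1) * (1 + 1 / ((K : ℝ) + J + 1)) := by
      push_cast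
      field_simp
      ring
    rw [e, Real.log_mul (by positivity) (by positivity)]
    have := Real.log_le_sub_one_of_pos (by positivity : 0 < 1 + 1 / ((K : ℝ) + J + 1))
    linarith

theorem eventually_log_two_sub_mul_le_sum_div {ε : ℝ} (hε : 0 < ε) :
    ∀ᶠ N : ℕ in atTop, (Real.log 2 - ε) * N ≤
      ∑ p ∈ (Finset.Ioc 0 N).filter (fun p => p.Prime ∧ N < p * p), ((N / p : ℕ) : ℝ) := by
  obtain ⟨C, hC0, hC⟩ := sum_Ioc_pow_inv_prime_ge
  have hK : Tendsto (fun K : ℕ => Real.log (2 - 2 / ((K : ℝ) + 1))) atTop (𝓝 (Real.log 2)) := by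
    have h1 : Tendsto (fun K : ℕ => 2 - 2 * (1 / ((K : ℝ) + 1))) atTop (𝓝 (2 - 2 * 0)) :=
      (tendsto_one_div_add_atTop_nhds_zero_nat.const_mul 2).const_sub 2
    have h2 : Tendsto (fun K : ℕ => 2 - 2 / ((K : ℝ) + 1)) atTop (𝓝 2) := by
      simpa [div_eq_mul_inv] using h1
    exact h2.log (by norm_num)
  obtain ⟨K, hK1, hK0⟩ := ((hK.eventually_const_lt (by linarith : Real.log 2 - ε < _)).and
    (eventually_gt_atTop 0)).exists
  -- With `N = x^(2K)`, the primes run from `x^K = √N` to `x^(2K-1) = N / x`. Stopping there keeps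
  -- the total rounding loss in `⌊N/p⌋` below `N / x`.
  obtain ⟨J, rfl⟩ : ∃ J, K = J + 1 := ⟨K - 1, by omega⟩
  set K := J + 1 with hKdef
  have hKR : (0 : ℝ) < K := by exact_mod_cast hK0
  have hx : Tendsto (fun N : ℕ => (N : ℝ) ^ (1 / (2 * K : ℝ))) atTop atTop :=
    (tendsto_rpow_atTop (by positivity)).comp tendsto_natCast_atTop_atTop
  have hlim : Tendsto (fun x : ℝ => (1 - C / Real.log x) * Real.log (2 - 2 / ((K : ℝ) + 1)) - x⁻¹)
      atTop (𝓝 (Real.log (2 - 2 / ((K : ℝ) + 1)))) := by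
    simpa using (((Real.tendsto_log_atTop.const_div_atTop C).const_sub 1).mul_const
      (Real.log (2 - 2 / ((K : ℝ) + 1)))).sub tendsto_inv_atTop_zero
  filter_upwards [(hlim.comp hx).eventually_const_lt hK1, hx.eventually_gt_atTop 1,
    (Real.tendsto_log_atTop.comp hx).eventually_gt_atTop C, eventually_gt_atTop 0]
    with N h1 h2 h3 hN
  have hNR : (0 : ℝ) < N := by exact_mod_cast hN
  set x := (N : ℝ) ^ (1 / (2 * K : ℝ)) with hxdef
  simp only [Function.comp_apply, ← hxdef] at h1 h3
  have hx0 : 0 < x := by linarith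
  have hxN : x ^ (2 * K) = N := by
    rw [hxdef, ← Real.rpow_natCast, ← Real.rpow_mul hNR.le]
    push_cast
    rw [one_div, inv_mul_cancel₀ (by positivity), Real.rpow_one]
  have hxJ : x ^ (K + J) = N * x⁻¹ := by
    rw [← hxN, show 2 * K = K + J + 1 by omega, pow_succ]
    field_simp
  have hsub : (Finset.Ioc ⌊x ^ K⌋₊ ⌊x ^ (K + J)⌋₊).filter Nat.Prime ⊆
      (Finset.Ioc 0 N).filter (fun p => p.Prime ∧ N < p * p) := by
    intro p hp
    simp only [Finset.mem_filter, Finset.mem_Ioc] at hp ⊢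
    obtain ⟨⟨ha, hb⟩, hpp⟩ := hp
    refine ⟨⟨hpp.pos, ?_⟩, hpp, ?_⟩
    · have := (Nat.le_floor_iff (by positivity)).mp hb
      have h4 : x ^ (K + J) ≤ x ^ (2 * K) := pow_le_pow_right₀ h2.le (by omega)
      rw [hxN] at h4
      exact_mod_cast this.trans h4
    · have := Nat.lt_of_floor_lt ha
      have h4 : (x ^ K) * (x ^ K) < (p : ℝ) * p := by gcongr
      rw [← pow_add, ← two_mul, hxN] at h4
      exact_mod_cast h4
  have hcard : (((Finset.Ioc ⌊x ^ K⌋₊ ⌊x ^ (K + J)⌋₊).filter Nat.Prime).card : ℝ) ≤ N * x⁻¹ := by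
    rw [← hxJ]
    refine le_trans ?_ (Nat.floor_le (by positivity))
    have : ((Finset.Ioc ⌊x ^ K⌋₊ ⌊x ^ (K + J)⌋₊).filter Nat.Prime).card ≤ ⌊x ^ (K + J)⌋₊ :=
      (Finset.card_filter_le _ _).trans (by simp)
    exact_mod_cast this
  have hharm : Real.log (2 - 2 / ((K : ℝ) + 1)) ≤
      ∑ i ∈ Finset.range J, 1 / ((K : ℝ) + i + 1) := by
    convert log_div_le_sum_inv K J using 2
    rw [hKdef]; push_cast
    field_simp
    ring
  have hfac : 0 ≤ 1 - C / Real.log x := by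
    rw [sub_nonneg, div_le_one (hC0.trans h3)]
    exact h3.le
  have hmain := hC x h2 K J hK0
  have hm2 := mul_le_mul_of_nonneg_left hharm hfac
  calc (Real.log 2 - ε) * N
      ≤ N * ∑ p ∈ (Finset.Ioc ⌊x ^ K⌋₊ ⌊x ^ (K + J)⌋₊).filter Nat.Prime, 1 / (p : ℝ) -
          N * x⁻¹ := by
        rw [mul_comm, ← mul_sub]
        refine mul_le_mul_of_nonneg_left ?_ hNR.le
        linarith
    _ ≤ ∑ p ∈ (Finset.Ioc ⌊x ^ K⌋₊ ⌊x ^ (K + J)⌋₊).filter Nat.Prime, ((N / p : ℝ) - 1) := by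
        rw [Finset.sum_sub_distrib, Finset.sum_const, nsmul_eq_mul, mul_one, Finset.mul_sum]
        simp only [mul_one_div]
        linarith
    _ ≤ ∑ p ∈ (Finset.Ioc ⌊x ^ K⌋₊ ⌊x ^ (K + J)⌋₊).filter Nat.Prime, ((N / p : ℕ) : ℝ) := by
        refine Finset.sum_le_sum fun p _ => ?_
        have := Nat.lt_floor_add_one ((N : ℝ) / p)
        rw [Nat.floor_div_eq_div] at this
        linarith
    _ ≤ _ := Finset.sum_le_sum_of_subset_of_nonneg hsub fun p _ _ => Nat.cast_nonneg _

/-! ### Growth of the lcm through large prime divisors -/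

open Classical in
/-- The least common multiple of the elements of `A` in `[1, n]`. -/
noncomputable def lcmUpTo (A : Set ℕ) (n : ℕ) : ℕ := ((Finset.Icc 1 n).filter (· ∈ A)).lcm id

open Classical in
/-- The primes which divide some `a ∈ A`, `1 ≤ a ≤ n`, and exceed its square root. -/
noncomputable def largePrimeDivisors (A : Set ℕ) (n : ℕ) : Finset ℕ :=
  (Finset.Ioc 0 n).filter fun p => p.Prime ∧ ∃ a ∈ A, a ∈ Finset.Ioc 0 n ∧ p ∣ a ∧ a < p * p

theorem mem_largePrimeDivisors {A : Set ℕ} {n p : ℕ} :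
    p ∈ largePrimeDivisors A n ↔
      p.Prime ∧ ∃ a ∈ A, (0 < a ∧ a ≤ n) ∧ p ∣ a ∧ a < p * p := by
  simp only [largePrimeDivisors, Finset.mem_filter, Finset.mem_Ioc]
  refine ⟨fun h => h.2, fun h => ⟨?_, h⟩⟩
  obtain ⟨hp, a, _, ⟨h0, hn⟩, hpa, _⟩ := h
  exact ⟨hp.pos, (Nat.le_of_dvd h0 hpa).trans hn⟩

theorem lcmUpTo_dvd_iff {A : Set ℕ} {n k : ℕ} :
    lcmUpTo A n ∣ k ↔ ∀ a ∈ A, 0 < a → a ≤ n → a ∣ k := by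
  simp only [lcmUpTo, Finset.lcm_dvd_iff, Finset.mem_filter, Finset.mem_Icc, id]
  exact ⟨fun h a ha h0 hn => h a ⟨⟨h0, hn⟩, ha⟩, fun h a ha => h a ha.2 ha.1.1 ha.1.2⟩

theorem dvd_lcmUpTo {A : Set ℕ} {n a : ℕ} (ha : a ∈ A) (h0 : 0 < a) (hn : a ≤ n) :
    a ∣ lcmUpTo A n :=
  lcmUpTo_dvd_iff.mp dvd_rfl a ha h0 hn

theorem lcmUpTo_pos (A : Set ℕ) (n : ℕ) : 0 < lcmUpTo A n := by
  refine Nat.pos_of_dvd_of_pos (lcmUpTo_dvd_iff.mpr fun a _ h0 hn => ?_) n.factorial_pos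
  exact Nat.dvd_factorial h0 hn

theorem lcmUpTo_dvd_lcmUpTo (A : Set ℕ) (m n : ℕ) (h : m ≤ n) : lcmUpTo A m ∣ lcmUpTo A n :=
  lcmUpTo_dvd_iff.mpr fun _ ha h0 hm => dvd_lcmUpTo ha h0 (hm.trans h)

theorem Nat.Prime.exists_dvd_of_dvd_lcmUpTo {A : Set ℕ} {n p : ℕ} (hp : p.Prime)
    (h : p ∣ lcmUpTo A n) : ∃ a ∈ A, (0 < a ∧ a ≤ n) ∧ p ∣ a := by
  classical
  have h2 : p ∣ ∏ a ∈ (Finset.Icc 1 n).filter (· ∈ A), a :=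
    h.trans (Finset.lcm_dvd fun a ha => Finset.dvd_prod_of_mem _ ha)
  obtain ⟨a, ha, hpa⟩ := (hp.prime.dvd_finsetProd_iff _).mp h2
  simp only [Finset.mem_filter, Finset.mem_Icc] at ha
  exact ⟨a, ha.2, ha.1, hpa⟩

theorem largePrimeDivisors_mono {A B : Set ℕ} (hAB : A ⊆ B) {m n : ℕ} (h : m ≤ n) :
    largePrimeDivisors A m ⊆ largePrimeDivisors B n := by
  intro p
  simp only [mem_largePrimeDivisors]
  rintro ⟨hp, a, ha, ⟨h0, hm⟩, h2⟩
  exact ⟨hp, a, hAB ha, ⟨h0, hm.trans h⟩, h2⟩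

theorem lcmUpTo_mul_sqrt_pow_le (A : Set ℕ) (n m : ℕ) (h : n ≤ m) :
    (lcmUpTo A n : ℝ) * √(n : ℝ) ^ ((largePrimeDivisors A m).card - (largePrimeDivisors A n).card) ≤
      lcmUpTo A m := by
  set D := largePrimeDivisors A m \ largePrimeDivisors A n with hD
  have hmem : ∀ p ∈ D, p.Prime ∧ p ∣ lcmUpTo A m ∧ ¬ p ∣ lcmUpTo A n ∧ n ≤ p * p := by
    intro p hp
    rw [hD, Finset.mem_sdiff, mem_largePrimeDivisors, mem_largePrimeDivisors] at hp
    obtain ⟨⟨hpp, a, ha, ⟨h0, ham⟩, hpa, hap⟩, hn⟩ := hp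
    have hna : n < a := by
      by_contra! hle
      exact hn ⟨hpp, a, ha, ⟨h0, hle⟩, hpa, hap⟩
    refine ⟨hpp, hpa.trans (dvd_lcmUpTo ha h0 ham), fun hdvd => ?_, by omega⟩
    obtain ⟨b, hb, ⟨hb0, hbn⟩, hpb⟩ := hpp.exists_dvd_of_dvd_lcmUpTo hdvd
    -- As `b ≤ n < a < p²`, the element `b` would already make `p` count at `n`.
    exact hn ⟨hpp, b, hb, ⟨hb0, hbn⟩, hpb, by omega⟩
  have hprod : ∏ p ∈ D, p ∣ lcmUpTo A m :=
    Finset.prod_primes_dvd _ (fun p hp => (hmem p hp).1.prime) fun p hp => (hmem p hp).2.1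
  have hcop : Nat.Coprime (lcmUpTo A n) (∏ p ∈ D, p) :=
    Nat.Coprime.prod_right fun p hp =>
      (((hmem p hp).1.coprime_iff_not_dvd).mpr (hmem p hp).2.2.1).symm
  have hle := Nat.le_of_dvd (lcmUpTo_pos A m)
    (hcop.mul_dvd_of_dvd_of_dvd (lcmUpTo_dvd_lcmUpTo A n m h) hprod)
  have hcard : D.card = (largePrimeDivisors A m).card - (largePrimeDivisors A n).card :=
    Finset.card_sdiff_of_subset (largePrimeDivisors_mono subset_rfl h)
  have hsq : √(n : ℝ) ^ D.card ≤ ∏ p ∈ D, (p : ℝ) := by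
    rw [← Finset.prod_const]
    refine Finset.prod_le_prod (fun _ _ => Real.sqrt_nonneg _) fun p hp => ?_
    rw [Real.sqrt_le_left (Nat.cast_nonneg p), sq]
    exact_mod_cast (hmem p hp).2.2.2
  rw [← hcard]
  calc _ ≤ (lcmUpTo A n : ℝ) * ∏ p ∈ D, (p : ℝ) := by gcongr
    _ ≤ _ := by rw [← Nat.cast_prod]; exact_mod_cast hle

theorem tendsto_sub_rpow_atTop {F : ℕ → ℝ} {c σ τ : ℝ} (hc : 0 < c) (hσ : 0 < σ) (hστ : σ < τ)
    (h : ∀ᶠ n : ℕ in atTop, c * (n : ℝ) ^ τ ≤ F n) :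
    Tendsto (fun n : ℕ => F n - (n : ℝ) ^ σ) atTop atTop := by
  have h1 : Tendsto (fun n : ℕ => (n : ℝ) ^ σ) atTop atTop :=
    (tendsto_rpow_atTop hσ).comp tendsto_natCast_atTop_atTop
  have h2 : Tendsto (fun n : ℕ => c * (n : ℝ) ^ (τ - σ) + -1) atTop atTop :=
    tendsto_atTop_add_const_right _ _
      (((tendsto_rpow_atTop (by linarith)).comp tendsto_natCast_atTop_atTop).const_mul_atTop hc)
  refine tendsto_atTop_mono' _ ?_ (h1.atTop_mul_atTop₀ h2)
  filter_upwards [h, eventually_gt_atTop 0] with n hn hn0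
  have e : (n : ℝ) ^ τ = (n : ℝ) ^ σ * (n : ℝ) ^ (τ - σ) := by
    rw [← Real.rpow_add (by exact_mod_cast hn0)]; congr 1; ring
  rw [e] at hn
  linarith

theorem summable_and_irrational_of_card_largePrimeDivisors {A : Set ℕ} {c η : ℝ} (hc : 0 < c)
    (hη : 0 < η) (hη1 : η ≤ 1 / 2)
    (h : ∀ᶠ n : ℕ in atTop, c * (n : ℝ) ^ (1 / 2 + η) ≤ (largePrimeDivisors A n).card) :
    (Summable fun n => 1 / (lcmUpTo A n : ℝ)) ∧ Irrational (∑' n, 1 / (lcmUpTo A n : ℝ)) :=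
  summable_and_irrational_of_growth (F := fun n => (largePrimeDivisors A n).card) (lcmUpTo_pos A)
    (lcmUpTo_dvd_lcmUpTo A)
    (fun _ _ hmn => Finset.card_le_card (largePrimeDivisors_mono subset_rfl hmn))
    (lcmUpTo_mul_sqrt_pow_le A) (σ := 1 / 2 + η / 2) (by linarith) (by linarith)
    (tendsto_sub_rpow_atTop hc (by linarith) (by linarith) h)

/-! ### Sets containing every prime -/

theorem eventually_rpow_le_primeCounting :
    ∀ᶠ n : ℕ in atTop, (n : ℝ) ^ (1 / 2 + 1 / 4 : ℝ) ≤ Nat.primeCounting n := by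
  have h1 := ((isLittleO_log_rpow_atTop (r := 1 / 4) (by norm_num)).comp_tendsto
    tendsto_natCast_atTop_atTop).bound (c := 1 / 4) (by norm_num)
  have h2 : Tendsto (fun n : ℕ => (n : ℝ) + 1) atTop atTop :=
    tendsto_atTop_add_const_right _ _ tendsto_natCast_atTop_atTop
  have h3 := (Real.isLittleO_log_id_atTop.comp_tendsto h2).bound (c := 1 / 20) (by norm_num)
  filter_upwards [h1, h3, eventually_ge_atTop 2] with n hn1 hn3 hn
  have hnR : (2 : ℝ) ≤ n := by exact_mod_cast hn
  have hl : 0 < Real.log n := Real.log_pos (by linarith)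
  simp only [Function.comp_apply, id, Real.norm_eq_abs] at hn1 hn3
  rw [abs_of_nonneg (Real.rpow_nonneg (by linarith) _)] at hn1
  rw [abs_of_nonneg (by linarith : (0 : ℝ) ≤ n + 1)] at hn3
  refine le_trans ?_ (Chebyshev.pi_ge n)
  rw [le_div_iff₀ hl]
  have hl2 := Real.log_two_gt_d9
  have e : (n : ℝ) ^ (1 / 2 + 1 / 4 : ℝ) * (n : ℝ) ^ (1 / 4 : ℝ) = n := by
    rw [← Real.rpow_add (by linarith)]; norm_num
  have h4 : (n : ℝ) ^ (1 / 2 + 1 / 4 : ℝ) * Real.log n ≤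
      (n : ℝ) ^ (1 / 2 + 1 / 4 : ℝ) * (1 / 4 * (n : ℝ) ^ (1 / 4 : ℝ)) := by
    gcongr
    exact (le_abs_self _).trans hn1
  have h5 := (le_abs_self _).trans hn3
  nlinarith

theorem primeCounting_le_card_largePrimeDivisors {A : Set ℕ} (hA : ∀ p : ℕ, p.Prime → p ∈ A)
    (n : ℕ) : Nat.primeCounting n ≤ (largePrimeDivisors A n).card := by
  rw [← Nat.primesLE_card_eq_primeCounting]
  refine Finset.card_le_card fun p hp => ?_
  have hpp := Nat.prime_of_mem_primesLE hp
  have hpn := Nat.le_of_mem_primesLE hp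
  exact mem_largePrimeDivisors.mpr ⟨hpp, p, hA p hpp, ⟨hpp.pos, hpn⟩, dvd_rfl, by
    nlinarith [hpp.two_le]⟩

theorem summable_and_irrational_of_forall_prime_mem {A : Set ℕ}
    (hA : ∀ p : ℕ, p.Prime → p ∈ A) :
    (Summable fun n => 1 / (lcmUpTo A n : ℝ)) ∧ Irrational (∑' n, 1 / (lcmUpTo A n : ℝ)) := by
  refine summable_and_irrational_of_card_largePrimeDivisors one_pos (η := 1 / 4) (by norm_num)
    (by norm_num) ?_
  filter_upwards [eventually_rpow_le_primeCounting] with n hn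
  rw [one_mul]
  exact hn.trans (by exact_mod_cast primeCounting_le_card_largePrimeDivisors hA n)

/-! ### Sets of lower density above `1 - log 2` -/

-- Distinct primes above `√N` have product above `N`, so their sets of multiples up to `N` are
-- disjoint.
open Classical in
theorem sum_div_le_card_filter_exists_dvd (N : ℕ) :
    ∑ p ∈ (Finset.Ioc 0 N).filter (fun p => p.Prime ∧ N < p * p), N / p ≤
      ((Finset.Ioc 0 N).filter fun n => ∃ p, p.Prime ∧ N < p * p ∧ p ∣ n).card := by
  calc _ = ∑ p ∈ (Finset.Ioc 0 N).filter (fun p => p.Prime ∧ N < p * p),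
        ((Finset.Ioc 0 N).filter (p ∣ ·)).card := by simp only [Nat.Ioc_filter_dvd_card_eq_div]
    _ = _ := (Finset.card_biUnion ?_).symm
    _ ≤ _ := Finset.card_le_card ?_
  · intro p hp q hq hpq
    simp only [Finset.coe_filter, Set.mem_ofPred_eq] at hp hq
    refine Finset.disjoint_left.mpr ?_
    intro n hnp hnq
    simp only [Finset.mem_filter, Finset.mem_Ioc] at hnp hnq
    have hdvd := ((Nat.coprime_primes hp.2.1 hq.2.1).mpr hpq).mul_dvd_of_dvd_of_dvd hnp.2 hnq.2
    have hle := Nat.le_of_dvd hnp.1.1 hdvd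
    rcases le_total p q with h | h
    · nlinarith [hp.2.2, hnp.1.2]
    · nlinarith [hq.2.2, hnp.1.2]
  · intro n
    simp only [Finset.mem_biUnion, Finset.mem_filter]
    rintro ⟨p, hp, hn, hpn⟩
    exact ⟨hn, p, hp.2.1, hp.2.2, hpn⟩

/-- Inclusion–exclusion for `A` and the integers with a prime factor above `√N`: an element of both
is a multiple of a prime counted in `largePrimeDivisors A N`. -/
theorem card_add_sum_div_le (A : Set ℕ) [DecidablePred (· ∈ A)] (N : ℕ) :
    ((Finset.Ioc 0 N).filter (· ∈ A)).card +
      ∑ p ∈ (Finset.Ioc 0 N).filter (fun p => p.Prime ∧ N < p * p), N / p ≤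
      N + ∑ p ∈ (largePrimeDivisors A N).filter (fun p => N < p * p), N / p := by
  classical
  set S := (Finset.Ioc 0 N).filter (· ∈ A)
  set T := (Finset.Ioc 0 N).filter fun n => ∃ p, p.Prime ∧ N < p * p ∧ p ∣ n with hT
  have h1 := Finset.card_union_add_card_inter S T
  have h2 : (S ∪ T).card ≤ N := by
    refine (Finset.card_le_card (Finset.union_subset (Finset.filter_subset _ _)
      (Finset.filter_subset _ _))).trans ?_
    simp
  have h3 : (S ∩ T).card ≤
      ∑ p ∈ (largePrimeDivisors A N).filter (fun p => N < p * p), N / p := by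
    simp only [← Nat.Ioc_filter_dvd_card_eq_div]
    refine le_trans (Finset.card_le_card ?_) Finset.card_biUnion_le
    intro n hn
    simp only [S, hT, Finset.mem_inter, Finset.mem_filter] at hn
    obtain ⟨⟨hnN, hnA⟩, -, p, hp, hpN, hpn⟩ := hn
    simp only [Finset.mem_biUnion, Finset.mem_filter]
    have hn' := Finset.mem_Ioc.mp hnN
    exact ⟨p, ⟨mem_largePrimeDivisors.mpr ⟨hp, n, hnA, hn', hpn, by omega⟩, hpN⟩, hnN, hpn⟩
  have h4 := sum_div_le_card_filter_exists_dvd N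
  rw [← hT] at h4
  omega

theorem eventually_mul_le_card_of_lt_lowerAsymptoticDensity {A : Set ℕ} [DecidablePred (· ∈ A)]
    (hA : ∀ a ∈ A, 0 < a) {d : ℝ} (hd : d < lowerAsymptoticDensity A) :
    ∀ᶠ N : ℕ in atTop, d * N ≤ ((Finset.Ioc 0 N).filter (· ∈ A)).card := by
  have hb : IsBoundedUnder (· ≥ ·) atTop
      (fun N : ℕ => ({a ∈ A | a ≤ N}.ncard : ℝ) / (N : ℝ)) :=
    isBoundedUnder_of ⟨0, fun N => by positivity⟩
  filter_upwards [eventually_lt_of_lt_liminf hd hb, eventually_gt_atTop 0] with N hN hN0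
  have hset : {a ∈ A | a ≤ N} = ((Finset.Ioc 0 N).filter (· ∈ A) : Finset ℕ) := by
    ext a
    simp only [Set.mem_ofPred_eq, Finset.coe_filter, Finset.mem_Ioc]
    exact ⟨fun h => ⟨⟨hA a h.1, h.2⟩, h.1⟩, fun h => ⟨h.2, h.1.2⟩⟩
  rw [hset, Set.ncard_coe_finset, lt_div_iff₀ (by exact_mod_cast hN0)] at hN
  exact hN.le

/-- The counted primes above `√N` have reciprocal sum at least `2δ`. Those up to `N^(1/2+η)` account
for at most `δ`, and each of the others contributes less than `N^(-1/2-η)`. -/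
theorem exists_rpow_le_card_largePrimeDivisors {A : Set ℕ} (hA : ∀ a ∈ A, 0 < a)
    (hd : 1 - Real.log 2 < lowerAsymptoticDensity A) :
    ∃ c η : ℝ, 0 < c ∧ 0 < η ∧ η ≤ 1 / 2 ∧
      ∀ᶠ n : ℕ in atTop, c * (n : ℝ) ^ (1 / 2 + η) ≤ (largePrimeDivisors A n).card := by
  classical
  obtain ⟨δ, hδ, hδd⟩ : ∃ δ > 0, 1 - Real.log 2 + 3 * δ < lowerAsymptoticDensity A :=
    ⟨(lowerAsymptoticDensity A - (1 - Real.log 2)) / 6, by linarith, by linarith⟩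
  obtain ⟨η, hη0, hη1, hη⟩ := eventually_sum_inv_prime_sqrt_rpow_le hδ
  refine ⟨δ, η, hδ, hη0, hη1, ?_⟩
  filter_upwards [eventually_mul_le_card_of_lt_lowerAsymptoticDensity hA hδd, hη,
    eventually_log_two_sub_mul_le_sum_div hδ, eventually_gt_atTop 0] with N h1 h2 h3 hN0
  have hN : (0 : ℝ) < N := by exact_mod_cast hN0
  have h4 : ((((Finset.Ioc 0 N).filter (· ∈ A)).card : ℝ) +
      ∑ p ∈ (Finset.Ioc 0 N).filter (fun p => p.Prime ∧ N < p * p), ((N / p : ℕ) : ℝ)) ≤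
      N + ∑ p ∈ (largePrimeDivisors A N).filter (fun p => N < p * p), ((N / p : ℕ) : ℝ) := by
    exact_mod_cast card_add_sum_div_le A N
  set y := (N : ℝ) ^ (1 / 2 + η) with hy
  have hy0 : 0 < y := Real.rpow_pos_of_pos hN _
  set B := (largePrimeDivisors A N).filter (fun p => N < p * p)
  have h5 : ∑ p ∈ B, ((N / p : ℕ) : ℝ) ≤ N * ∑ p ∈ B, 1 / (p : ℝ) := by
    rw [Finset.mul_sum]
    refine Finset.sum_le_sum fun p _ => ?_
    rw [mul_one_div]
    exact Nat.cast_div_le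
  have h6 : 2 * δ ≤ ∑ p ∈ B, 1 / (p : ℝ) := by
    refine le_of_mul_le_mul_left ?_ hN
    linarith
  have h7 : ∑ p ∈ B.filter (fun p : ℕ => (p : ℝ) ≤ y), 1 / (p : ℝ) ≤ δ := by
    refine le_trans (Finset.sum_le_sum_of_subset_of_nonneg ?_ fun _ _ _ => by positivity) h2
    intro p hp
    simp only [B, Finset.mem_filter, mem_largePrimeDivisors] at hp
    simp only [Finset.mem_filter, Finset.mem_Ioc]
    refine ⟨⟨?_, Nat.le_floor hp.2⟩, hp.1.1.1⟩
    rw [Nat.floor_lt (by positivity), ← Real.sqrt_eq_rpow, Real.sqrt_lt' (by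
      exact_mod_cast hp.1.1.1.pos), sq]
    exact_mod_cast hp.1.2
  have h8 : ∑ p ∈ B.filter (fun p : ℕ => ¬ (p : ℝ) ≤ y), 1 / (p : ℝ) ≤
      (largePrimeDivisors A N).card * (1 / y) := by
    calc _ ≤ ∑ p ∈ B.filter (fun p : ℕ => ¬ (p : ℝ) ≤ y), 1 / y := by
          refine Finset.sum_le_sum fun p hp => ?_
          have := (Finset.mem_filter.mp hp).2
          gcongr
          exact (not_le.mp this).le
      _ ≤ _ := by
          rw [Finset.sum_const, nsmul_eq_mul]
          gcongr
          exact (Finset.filter_subset _ _).trans (Finset.filter_subset _ _)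
  have h9 := Finset.sum_filter_add_sum_filter_not B (fun p : ℕ => (p : ℝ) ≤ y)
    (fun p => 1 / (p : ℝ))
  have h10 : δ ≤ (largePrimeDivisors A N).card * (1 / y) := by linarith
  rwa [mul_one_div, le_div_iff₀ hy0] at h10

/-! ### Mean value of the least non-divisor -/

/-- Otherwise every `lcmUpTo A m` divides `n`, so the terms of the series do not tend to `0`. This
excludes the default value `sInf ∅ = 0` in `leastNonDivisor`. -/
theorem exists_not_dvd_of_summable {A : Set ℕ}
    (hs : Summable fun m => 1 / (lcmUpTo A m : ℝ)) {n : ℕ} (hn : 0 < n) :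
    ∃ a ∈ A, ¬ a ∣ n := by
  by_contra! h
  have hle : ∀ m, lcmUpTo A m ≤ n := fun m =>
    Nat.le_of_dvd hn (lcmUpTo_dvd_iff.mpr fun a ha _ _ => h a ha)
  have hn' : (0 : ℝ) < 1 / n := by positivity
  obtain ⟨m, hm⟩ := (hs.tendsto_atTop_zero.eventually_lt_const hn').exists
  have h1 : (0 : ℝ) < lcmUpTo A m := by exact_mod_cast lcmUpTo_pos A m
  have h2 : (lcmUpTo A m : ℝ) ≤ n := by exact_mod_cast hle m
  exact absurd hm (not_lt.mpr (by gcongr))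

theorem lt_leastNonDivisor_iff {A : Set ℕ} (hA : ∀ a ∈ A, 0 < a) {n : ℕ}
    (h : ∃ a ∈ A, ¬ a ∣ n) (m : ℕ) : m < leastNonDivisor A n ↔ lcmUpTo A m ∣ n := by
  have hne : {a ∈ A | ¬ a ∣ n}.Nonempty := h
  rw [lcmUpTo_dvd_iff, leastNonDivisor]
  constructor
  · intro hm a ha _ ham
    by_contra hdvd
    have : sInf {a ∈ A | ¬ a ∣ n} ≤ a := Nat.sInf_le ⟨ha, hdvd⟩
    omega
  · intro hm
    by_contra! hle
    obtain ⟨h1, h2⟩ := Nat.sInf_mem hne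
    exact h2 (hm _ h1 (hA _ h1) hle)

theorem hasSum_leastNonDivisor {A : Set ℕ} (hA : ∀ a ∈ A, 0 < a) {n : ℕ}
    (h : ∃ a ∈ A, ¬ a ∣ n) :
    HasSum (fun m => if lcmUpTo A m ∣ n then (1 : ℝ) else 0) (leastNonDivisor A n) := by
  simp only [← lt_leastNonDivisor_iff hA h]
  have hcard : ((leastNonDivisor A n : ℕ) : ℝ) = ∑ m ∈ Finset.range (leastNonDivisor A n),
      if m < leastNonDivisor A n then (1 : ℝ) else 0 := by
    rw [Finset.sum_congr rfl fun m hm => if_pos (Finset.mem_range.mp hm)]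
    simp
  refine hcard ▸ hasSum_sum_of_ne_finset_zero fun m hm => ?_
  exact if_neg fun hlt => hm (Finset.mem_range.mpr hlt)

theorem hasSum_sum_leastNonDivisor {A : Set ℕ} (hA : ∀ a ∈ A, 0 < a)
    (hs : Summable fun m => 1 / (lcmUpTo A m : ℝ)) (N : ℕ) :
    HasSum (fun m => ((N / lcmUpTo A m : ℕ) : ℝ))
      (∑ n ∈ Finset.Icc 1 N, (leastNonDivisor A n : ℝ)) := by
  have h := hasSum_sum fun n (hn : n ∈ Finset.Icc 1 N) =>
    hasSum_leastNonDivisor hA (exists_not_dvd_of_summable hs (Finset.mem_Icc.mp hn).1)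
  convert h using 2 with m
  rw [← Nat.Ioc_filter_dvd_card_eq_div, Finset.sum_boole]
  rfl

/-- Termwise `⌊N / L⌋ / N → 1 / L`, dominated by `1 / L` uniformly in `N`. -/
theorem tendsto_sum_leastNonDivisor_div {A : Set ℕ} (hA : ∀ a ∈ A, 0 < a)
    (hs : Summable fun m => 1 / (lcmUpTo A m : ℝ)) :
    Tendsto (fun N : ℕ => (∑ n ∈ Finset.Icc 1 N, (leastNonDivisor A n : ℝ)) / (N : ℝ)) atTop
      (𝓝 (∑' m, 1 / (lcmUpTo A m : ℝ))) := by
  simp only [← (hasSum_sum_leastNonDivisor hA hs _).tsum_eq, ← tsum_div_const]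
  refine tendsto_tsum_of_dominated_convergence hs (fun m => ?_) (Eventually.of_forall fun N m => ?_)
  · have h := (tendsto_nat_floor_mul_div_atTop
      (by positivity : 0 ≤ 1 / (lcmUpTo A m : ℝ))).comp tendsto_natCast_atTop_atTop
    refine h.congr fun N => ?_
    rw [Function.comp_apply, one_div_mul_eq_div, Nat.floor_div_eq_div]
  · rw [Real.norm_of_nonneg (by positivity)]
    refine div_le_of_le_mul₀ (by positivity) (by positivity) ?_
    rw [one_div_mul_eq_div]
    exact Nat.cast_div_le

/-! ### The two constants and the conclusion -/

theorem ellOneTerm_eq (n : ℕ) : ellOneTerm n = 1 / (lcmUpTo Set.univ n : ℝ) := by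
  simp [ellOneTerm, lcmUpTo]

theorem lcmUpTo_setOf_prime (n : ℕ) :
    lcmUpTo {p | p.Prime} n = ∏ p ∈ (Finset.Icc 1 n).filter Nat.Prime, p := by
  refine Nat.dvd_antisymm (lcmUpTo_dvd_iff.mpr fun p hp h0 hn => ?_)
    (Finset.prod_primes_dvd _ (fun p hp => (Finset.mem_filter.mp hp).2.prime) fun p hp => ?_)
  · exact Finset.dvd_prod_of_mem _ (Finset.mem_filter.mpr ⟨Finset.mem_Icc.mpr ⟨h0, hn⟩, hp⟩)
  · obtain ⟨h, hp⟩ := Finset.mem_filter.mp hp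
    exact dvd_lcmUpTo hp hp.pos (Finset.mem_Icc.mp h).2

theorem ellTwoTerm_eq (n : ℕ) : ellTwoTerm n = 1 / (lcmUpTo {p | p.Prime} n : ℝ) := by
  rw [ellTwoTerm, lcmUpTo_setOf_prime]

theorem proposition1 :
    (∀ A : Set ℕ, (∀ a ∈ A, 0 < a) → 1 - Real.log 2 < lowerAsymptoticDensity A →
      ∃ l : ℝ,
        Tendsto (fun N : ℕ => (∑ n ∈ Finset.Icc 1 N, (leastNonDivisor A n : ℝ)) / (N : ℝ))
          atTop (𝓝 l) ∧
        Irrational l) ∧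
    (Summable ellOneTerm ∧ Irrational ellOne) ∧
    (Summable ellTwoTerm ∧ Irrational ellTwo) := by
  refine ⟨fun A hA hd => ?_, ?_, ?_⟩
  · obtain ⟨c, η, hc, hη0, hη1, h⟩ := exists_rpow_le_card_largePrimeDivisors hA hd
    obtain ⟨hs, hirr⟩ := summable_and_irrational_of_card_largePrimeDivisors hc hη0 hη1 h
    exact ⟨_, tendsto_sum_leastNonDivisor_div hA hs, hirr⟩
  · rw [ellOne, funext ellOneTerm_eq]
    exact summable_and_irrational_of_forall_prime_mem fun p _ => Set.mem_univ p
  · rw [ellTwo, funext ellTwoTerm_eq]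
    exact summable_and_irrational_of_forall_prime_mem fun p hp => hp
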